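/- Let $C([0,\infty])$ be the space of (real- or complex-valued) continuous functions on $[0,\infty)$ that have a finite limit at infinity, with the sup-norm. Let $\gamma>0$. For $b\ge 0$, $t>0$ and $x\ge 0$ let $$P_t^{\gamma,b}f(x)=\int_0^\infty p^{\gamma,b}(x,y,t)f(y)\,dy ,\qquad f\in C([0,\infty]),$$ where, for $b>0$, $$p^{\gamma,b}(x,y,t)=(\gamma t)^{-\frac b\gamma}e^{-\frac{x+y}{\gamma t}}\,y^{\frac b\gamma-1}\sum_{m=0}^\infty\frac{1}{m!\,\Gamma(m+\frac b\gamma)}\,\frac{x^my^m}{\gamma^{2m}t^{2m}},$$ and, for $b=0$, with $\delta_0$ the unit point mass at $0$, $$p^{\gamma,0}(x,y,t)=e^{-\frac{x}{\gamma t}}\delta_0(y)+(\gamma t)^{-1}e^{-\frac{x+y}{\gamma t}}\sum_{m=0}^\infty\frac{1}{(m+1)!\,m!}\,\frac{x^{m+1}y^m}{\gamma^{2m+1}t^{2m+1}};$$ moreover let $P_0^{\gamma,b}=I$. Then each $P_t^{\gamma,b}$ ($b\ge 0$, $t\ge 0$) is a well-defined bounded linear operator from $C([0,\infty])$ into itself,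 and for every $f\in C([0,\infty])$ $$\lim_{b\to 0^+}P_t^{\gamma,b}f=P_t^{\gamma,0}f\quad\text{in } C([0,\infty]),$$ uniformly for $t$ in compact intervals of $[0,\infty)$. -/

import Mathlib

open MeasureTheory Filter Topology Set
open scoped NNReal BoundedContinuousFunction Nat

/-- The space `C([0,∞])` of (real- or complex-valued) continuous functions on `[0,∞)` that have a
finite limit at infinity, with the sup-norm. Such functions are automatically bounded, so the space
is a subspace of the bounded continuous functions on `[0,∞)`. -/
def CZeroInfty (𝕜 : Type*) [RCLike 𝕜] : Submodule 𝕜 (ℝ≥0 →ᵇ 𝕜) where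
  carrier := {f | ∃ l : 𝕜, Tendsto f atTop (𝓝 l)}
  add_mem' := by
    rintro f g ⟨l, hl⟩ ⟨m, hm⟩
    exact ⟨l + m, hl.add hm⟩
  zero_mem' := ⟨0, tendsto_const_nhds (x := (0 : 𝕜))⟩
  smul_mem' := by
    rintro c f ⟨l, hl⟩
    exact ⟨c * l, hl.const_mul c⟩

/-- Lebesgue measure on `[0,∞)`. -/
noncomputable def lebesgueHalfLine : Measure ℝ≥0 :=
  Measure.comap ((↑) : ℝ≥0 → ℝ) volume

/-- The density `y ↦ p^{γ,b}(x,y,t)` of the transition kernel for `b > 0`. -/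
noncomputable def posDensity (γ b t x y : ℝ) : ℝ :=
  (γ * t) ^ (-(b / γ)) * Real.exp (-((x + y) / (γ * t))) * y ^ (b / γ - 1) *
    ∑' m : ℕ, 1 / (m ! * Real.Gamma (m + b / γ)) *
      (x ^ m * y ^ m / (γ ^ (2 * m) * t ^ (2 * m)))

/-- The density of the absolutely continuous part of the transition kernel for `b = 0`. -/
noncomputable def zeroDensity (γ t x y : ℝ) : ℝ :=
  (γ * t)⁻¹ * Real.exp (-((x + y) / (γ * t))) *
    ∑' m : ℕ, 1 / ((m + 1)! * m ! : ℝ) *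
      (x ^ (m + 1) * y ^ m / (γ ^ (2 * m + 1) * t ^ (2 * m + 1)))

/-- The transition kernel `p^{γ,b}(x,y,t) dy`, a measure on `[0,∞)`; for `b = 0` it has the atom
`exp (-x / (γ t))` at the origin. It is meant for `γ > 0` and `t > 0`. -/
noncomputable def transitionKernel (γ : ℝ) (b t x : ℝ≥0) : Measure ℝ≥0 :=
  if b = 0 then
    ENNReal.ofReal (Real.exp (-(x / (γ * t)))) • Measure.dirac 0 +
      lebesgueHalfLine.withDensity (fun y => ENNReal.ofReal (zeroDensity γ t x y))
  else
    lebesgueHalfLine.withDensity (fun y => ENNReal.ofReal (posDensity γ b t x y))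

/-- The function `P_t^{γ,b} f` on `[0,∞)`: the integral of `f` against the transition kernel if
`t > 0`, and `f` itself if `t = 0`. -/
noncomputable def semigroupFun {𝕜 : Type*} [RCLike 𝕜] (γ : ℝ) (b t : ℝ≥0) (f : ℝ≥0 → 𝕜)
    (x : ℝ≥0) : 𝕜 :=
  if t = 0 then f x else ∫ y, f y ∂(transitionKernel γ b t x)

/-! The kernel is a Poisson mixture of gamma laws: draw `m` from the Poisson law of mean `x/(γt)`,
then `y` from the gamma law of shape `m + b/γ` and rate `1/(γt)`; for `b = 0` the shape-zero term `m
= 0` is the atom at the origin. Summing gamma Laplace transforms against Poisson weights gives the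
closed form `(1 + lγt)^(-b/γ) exp(-lx/(1 + lγt))` (`lintegral_exp_transitionKernel`).

At `l = 0` this is mass one, so each `P_t` is a contraction. At `l = n` it shows that `exp(-n x)` is
sent to a multiple of an exponential, and that passing from `b` to `0` costs at most `b n t` in norm
(`norm_semigroupOp_sub_expNeg_le`). These exponentials span a dense subspace
(`exists_mem_span_expNeg_norm_sub_le`), so invariance of the space and locally uniform convergence
both extend to every `f` by contractivity. -/

/-! ### Laplace transform of the transition kernel -/

open ProbabilityTheory in
lemma lintegral_Ici_gammaPDF_mul_exp {a r l : ℝ} (ha : 0 < a) (hr : 0 < r) (hl : 0 ≤ l) :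
    ∫⁻ y in Ici (0 : ℝ), gammaPDF a r y * ENNReal.ofReal (Real.exp (-(l * y))) =
      ENNReal.ofReal ((r / (r + l)) ^ a) := by
  have hrl : 0 < r + l := by positivity
  -- Exponential tilting: the factor `exp(-l y)` only changes the rate from `r` to `r + l`, up to
  -- normalisation.
  have h1 : ∀ y ∈ Ici (0 : ℝ), gammaPDF a r y * ENNReal.ofReal (Real.exp (-(l * y))) =
      ENNReal.ofReal ((r / (r + l)) ^ a) * gammaPDF a (r + l) y := by
    intro y hy
    rw [gammaPDF_of_nonneg hy, gammaPDF_of_nonneg hy, ← ENNReal.ofReal_mul' (Real.exp_nonneg _),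
      ← ENNReal.ofReal_mul (by positivity), Real.div_rpow hr.le hrl.le]
    congr 1
    have h2 : Real.exp (-((r + l) * y)) = Real.exp (-(r * y)) * Real.exp (-(l * y)) := by
      rw [← Real.exp_add]; ring_nf
    have h3 : (r + l) ^ a ≠ 0 := (Real.rpow_pos_of_pos hrl a).ne'
    rw [h2]
    field_simp
  have h4 : ∫⁻ y in Ici (0 : ℝ), gammaPDF a (r + l) y = 1 := by
    rw [← lintegral_gammaPDF_eq_one ha hrl, ← lintegral_add_compl (μ := volume) (gammaPDF a (r + l))
      (measurableSet_Ici (a := (0 : ℝ))), compl_Ici, lintegral_gammaPDF_of_nonpos le_rfl, add_zero]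
  rw [setLIntegral_congr_fun measurableSet_Ici h1, lintegral_const_mul _
    (by unfold gammaPDF; fun_prop), h4, mul_one]

lemma lintegral_lebesgueHalfLine (g : ℝ → ENNReal) :
    ∫⁻ y : ℝ≥0, g y ∂lebesgueHalfLine = ∫⁻ y in Ici (0 : ℝ), g y := by
  have h : MeasurableEmbedding ((↑) : ℝ≥0 → ℝ) :=
    MeasurableEmbedding.subtype_coe (s := {r : ℝ | 0 ≤ r}) measurableSet_Ici
  rw [lebesgueHalfLine, ← h.lintegral_map, h.map_comap]
  congr 2
  ext y
  simp

/-- The density expansions are proved for `y > 0` only, since `y ^ (m + β - 1) = y ^ m * y ^ (β -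
1)` can fail at `0`. -/
lemma lebesgueHalfLine_ae_ne_zero : ∀ᵐ y : ℝ≥0 ∂lebesgueHalfLine, y ≠ 0 := by
  have h : MeasurableEmbedding ((↑) : ℝ≥0 → ℝ) :=
    MeasurableEmbedding.subtype_coe (s := {r : ℝ | 0 ≤ r}) measurableSet_Ici
  rw [ae_iff, lebesgueHalfLine, h.comap_apply]
  simp

/-- The probability that a Poisson variable of mean `r` equals `m`. -/
noncomputable def poissonWeight (r : ℝ) (m : ℕ) : ℝ := Real.exp (-r) * (r ^ m / m !)

lemma poissonWeight_nonneg {r : ℝ} (hr : 0 ≤ r) (m : ℕ) : 0 ≤ poissonWeight r m := by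
  unfold poissonWeight; positivity

lemma hasSum_poissonWeight_mul_pow (r q : ℝ) :
    HasSum (fun m => poissonWeight r m * q ^ m) (Real.exp (r * q - r)) := by
  have h := (NormedSpace.expSeries_div_hasSum_exp (r * q)).mul_left (Real.exp (-r))
  rw [← Real.exp_eq_exp_ℝ, ← Real.exp_add, neg_add_eq_sub] at h
  refine h.congr_fun fun m => ?_
  unfold poissonWeight
  rw [mul_pow]
  ring

/-- By `Γ(z + 1) = z Γ(z)` the values are nondecreasing once `z ≥ 1`, hence from `m = 1` on; `m = 0`
is separate because `β` may be below `1`. The bound lets the exponential series dominate the kernel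
series. -/
lemma exists_pos_le_Gamma_nat_add {β : ℝ} (hβ : 0 < β) :
    ∃ c > 0, ∀ m : ℕ, c ≤ Real.Gamma (m + β) := by
  have h : ∀ m : ℕ, Real.Gamma (1 + β) ≤ Real.Gamma ((m + 1 : ℕ) + β) := by
    intro m
    induction m with
    | zero => simp
    | succ k ih =>
      refine ih.trans ?_
      have hk : (0 : ℝ) < (k + 1 : ℕ) + β := by positivity
      have e : ((k + 1 + 1 : ℕ) : ℝ) + β = ((k + 1 : ℕ) + β) + 1 := by push_cast; ring
      rw [e, Real.Gamma_add_one hk.ne']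
      refine le_mul_of_one_le_left (Real.Gamma_pos_of_pos hk).le ?_
      push_cast
      have : (0 : ℝ) ≤ k := by positivity
      linarith
  refine ⟨min (Real.Gamma β) (Real.Gamma (1 + β)), lt_min (Real.Gamma_pos_of_pos hβ)
    (Real.Gamma_pos_of_pos (by positivity)), ?_⟩
  rintro (_ | m)
  · simp
  · exact (min_le_right _ _).trans (h m)

lemma summable_pow_div_factorial_mul_Gamma {β z : ℝ} (hβ : 0 < β) (hz : 0 ≤ z) :
    Summable fun m : ℕ => z ^ m / (m ! * Real.Gamma (m + β)) := by
  obtain ⟨c, hc, h⟩ := exists_pos_le_Gamma_nat_add hβ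
  refine Summable.of_nonneg_of_le (fun m => ?_) (fun m => ?_)
    ((Real.summable_pow_div_factorial z).mul_left c⁻¹)
  · have := hc.trans_le (h m)
    positivity
  · have := h m
    rw [inv_mul_eq_div, div_div]
    gcongr

-- Matches the kernel series with the mixture term by term. The sign of `β` is left free so that `β
-- = 0` is covered.
open ProbabilityTheory in
lemma poissonWeight_mul_gammaPDFReal {s β x y : ℝ} (hs : 0 < s) (hy : 0 < y) (m : ℕ) :
    poissonWeight (x / s) m * gammaPDFReal (m + β) s⁻¹ y =
      s ^ (-β) * Real.exp (-((x + y) / s)) * y ^ (β - 1) *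
        ((x * y / s ^ 2) ^ m / (m ! * Real.Gamma (m + β))) := by
  have h1 : Real.exp (-((x + y) / s)) = Real.exp (-(x / s)) * Real.exp (-(s⁻¹ * y)) := by
    rw [← Real.exp_add]; congr 1; ring
  have h2 : s⁻¹ ^ (m + β) = s ^ (-β) / s ^ m := by
    rw [Real.inv_rpow hs.le, Real.rpow_add hs, Real.rpow_neg hs.le, Real.rpow_natCast]
    field_simp
  have h3 : y ^ (m + β - 1) = y ^ m * y ^ (β - 1) := by
    rw [add_sub_assoc, Real.rpow_add hy, Real.rpow_natCast]
  rw [poissonWeight, gammaPDFReal, if_pos hy.le, h1, h2, h3, div_pow, div_pow, mul_pow]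
  field_simp
  ring

open ProbabilityTheory in
lemma hasSum_posDensity {γ b t x y : ℝ} (hγ : 0 < γ) (hb : 0 < b) (ht : 0 < t) (hx : 0 ≤ x)
    (hy : 0 < y) :
    HasSum (fun m : ℕ => poissonWeight (x / (γ * t)) m * gammaPDFReal (m + b / γ) (γ * t)⁻¹ y)
      (posDensity γ b t x y) := by
  have hs : 0 < γ * t := by positivity
  have hβ : 0 < b / γ := by positivity
  simp_rw [poissonWeight_mul_gammaPDFReal hs hy]
  have h := (summable_pow_div_factorial_mul_Gamma (z := x * y / (γ * t) ^ 2) hβ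
    (by positivity)).hasSum
  have e : ∀ m : ℕ, 1 / (m ! * Real.Gamma (m + b / γ)) *
      (x ^ m * y ^ m / (γ ^ (2 * m) * t ^ (2 * m))) =
      (x * y / (γ * t) ^ 2) ^ m / (m ! * Real.Gamma (m + b / γ)) := by
    intro m
    rw [div_pow, mul_pow, ← pow_mul, mul_pow]
    ring
  simp_rw [posDensity, e]
  exact h.mul_left _

-- The index starts at `m + 1` because the term `m = 0` is the atom; the `+ 0` is `β = 0`.
open ProbabilityTheory in
lemma hasSum_zeroDensity {γ t x y : ℝ} (hγ : 0 < γ) (ht : 0 < t) (hx : 0 ≤ x) (hy : 0 < y) :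
    HasSum (fun m : ℕ => poissonWeight (x / (γ * t)) (m + 1) *
        gammaPDFReal ((m + 1 : ℕ) + 0) (γ * t)⁻¹ y)
      (zeroDensity γ t x y) := by
  have hs : 0 < γ * t := by positivity
  simp_rw [poissonWeight_mul_gammaPDFReal hs hy]
  have hsum : Summable fun m : ℕ => 1 / ((m + 1)! * m ! : ℝ) *
      (x ^ (m + 1) * y ^ m / (γ ^ (2 * m + 1) * t ^ (2 * m + 1))) := by
    have h0 := (summable_pow_div_factorial_mul_Gamma
      (z := x * y / (γ * t) ^ 2) one_pos (by positivity)).mul_left (x / (γ * t))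
    refine Summable.of_nonneg_of_le (fun m => by positivity) (fun m => ?_) h0
    rw [Real.Gamma_nat_eq_factorial, div_pow, mul_pow, ← pow_mul, mul_pow]
    have : (m ! : ℝ) ≤ (m + 1)! := by exact_mod_cast Nat.factorial_le (Nat.le_succ m)
    calc 1 / ((m + 1)! * m ! : ℝ) *
          (x ^ (m + 1) * y ^ m / (γ ^ (2 * m + 1) * t ^ (2 * m + 1)))
        ≤ 1 / (m ! * m ! : ℝ) *
          (x ^ (m + 1) * y ^ m / (γ ^ (2 * m + 1) * t ^ (2 * m + 1))) := by gcongr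
      _ = _ := by field_simp; ring
  unfold zeroDensity
  refine (hsum.hasSum.mul_left _).congr_fun fun m => ?_
  have h4 : Real.Gamma ((m + 1 : ℕ) + 0) = m ! := by
    rw [add_zero]; push_cast; exact Real.Gamma_nat_eq_factorial m
  rw [h4, div_pow, mul_pow, ← pow_mul, mul_pow]
  simp only [neg_zero, Real.rpow_zero, zero_sub, Real.rpow_neg_one]
  field_simp
  ring

open ProbabilityTheory in
lemma lintegral_exp_withDensity_tsum_gammaPDF {r l : ℝ} (hr : 0 < r) (hl : 0 ≤ l)
    {w a : ℕ → ℝ} (hw : ∀ m, 0 ≤ w m) (ha : ∀ m, 0 < a m) {ρ : ℝ≥0 → ℝ}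
    (hρ : ∀ y : ℝ≥0, 0 < y → HasSum (fun m => w m * gammaPDFReal (a m) r y) (ρ y)) :
    ∫⁻ y : ℝ≥0, ENNReal.ofReal (Real.exp (-(l * y)))
        ∂(lebesgueHalfLine.withDensity fun y => ENNReal.ofReal (ρ y)) =
      ∑' m, ENNReal.ofReal (w m * (r / (r + l)) ^ a m) := by
  have h1 : (fun y : ℝ≥0 => ENNReal.ofReal (ρ y)) =ᵐ[lebesgueHalfLine]
      fun y : ℝ≥0 => ∑' m, ENNReal.ofReal (w m) * gammaPDF (a m) r y := by
    filter_upwards [lebesgueHalfLine_ae_ne_zero] with y hy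
    have h := hρ y (pos_iff_ne_zero.2 hy)
    rw [← h.tsum_eq, ENNReal.ofReal_tsum_of_nonneg (fun m => mul_nonneg (hw m)
      (gammaPDFReal_nonneg (ha m) hr _)) h.summable]
    simp_rw [ENNReal.ofReal_mul (hw _), gammaPDF]
  have hmeas : ∀ m, Measurable (gammaPDF (a m) r) := fun m => by unfold gammaPDF; fun_prop
  rw [withDensity_congr_ae h1, lintegral_withDensity_eq_lintegral_mul _
    (by fun_prop) (by fun_prop)]
  simp only [Pi.mul_apply]
  rw [lintegral_lebesgueHalfLine fun y => (∑' m, ENNReal.ofReal (w m) * gammaPDF (a m) r y) *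
    ENNReal.ofReal (Real.exp (-(l * y)))]
  simp_rw [← ENNReal.tsum_mul_right, mul_assoc]
  rw [lintegral_tsum (fun m => by fun_prop)]
  congr 1 with m
  rw [lintegral_const_mul _ (by fun_prop), lintegral_Ici_gammaPDF_mul_exp (ha m) hr hl,
    ENNReal.ofReal_mul (hw m)]

/-- The Laplace transform of the transition kernel, `E exp (-l Y)`. -/
lemma lintegral_exp_transitionKernel {γ : ℝ} (hγ : 0 < γ) (b x : ℝ≥0) {t : ℝ≥0} (ht : 0 < t)
    {l : ℝ} (hl : 0 ≤ l) :
    ∫⁻ y : ℝ≥0, ENNReal.ofReal (Real.exp (-(l * y))) ∂(transitionKernel γ b t x) =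
      ENNReal.ofReal ((1 + l * (γ * t)) ^ (-(b / γ)) *
        Real.exp (-(l * x / (1 + l * (γ * t))))) := by
  have hs : 0 < γ * t := by positivity
  have hr : 0 < (γ * t)⁻¹ := by positivity
  have hd : 0 < 1 + l * (γ * t) := by positivity
  have hq : (γ * t)⁻¹ / ((γ * t)⁻¹ + l) = (1 + l * (γ * t))⁻¹ := by field_simp
  have hwn : ∀ m, 0 ≤ poissonWeight (x / (γ * t)) m := poissonWeight_nonneg (by positivity)
  have hsum := hasSum_poissonWeight_mul_pow (x / (γ * t)) (1 + l * (γ * t))⁻¹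
  have hexp : x / (γ * t) * (1 + l * (γ * t))⁻¹ - x / (γ * t) =
      -(l * x / (1 + l * (γ * t))) := by field_simp; ring
  rw [hexp] at hsum
  have hnn : ∀ m, 0 ≤ poissonWeight (x / (γ * t)) m * (1 + l * (γ * t))⁻¹ ^ m :=
    fun m => mul_nonneg (hwn m) (by positivity)
  by_cases hb : b = 0
  · subst hb
    rw [transitionKernel, if_pos rfl, lintegral_add_measure, lintegral_smul_measure,
      lintegral_dirac, lintegral_exp_withDensity_tsum_gammaPDF hr hl (fun m => hwn (m + 1))
        (a := fun m => (m + 1 : ℕ) + 0) (fun m => by positivity)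
        (fun y hy => hasSum_zeroDensity hγ ht x.2 hy), hq]
    simp only [NNReal.coe_zero, zero_div, neg_zero, Real.rpow_zero, one_mul, mul_zero,
      Real.exp_zero, ENNReal.ofReal_one, smul_eq_mul, mul_one, add_zero, Real.rpow_natCast]
    -- The `m = 0` term of the Poisson sum is the contribution of the atom.
    rw [← hsum.tsum_eq, ENNReal.ofReal_tsum_of_nonneg hnn hsum.summable,
      tsum_eq_zero_add' (f := fun m => ENNReal.ofReal (poissonWeight _ m * _)) ENNReal.summable]
    simp [poissonWeight]
  · have hb' : 0 < b := pos_iff_ne_zero.2 hb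
    have hb'' : (0 : ℝ) < b := hb'
    rw [transitionKernel, if_neg hb, lintegral_exp_withDensity_tsum_gammaPDF hr hl hwn
        (a := fun m => m + b / γ) (fun m => by positivity)
        (fun y hy => hasSum_posDensity hγ hb' ht x.2 hy), hq, ← hsum.tsum_eq, ← tsum_mul_left,
        ENNReal.ofReal_tsum_of_nonneg (fun m => mul_nonneg (by positivity) (hnn m))
        (hsum.summable.mul_left _)]
    congr 1 with m
    congr 1
    rw [Real.rpow_add (by positivity), Real.rpow_natCast, Real.inv_rpow hd.le,
      Real.rpow_neg hd.le]
    ring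

lemma isProbabilityMeasure_transitionKernel {γ : ℝ} (hγ : 0 < γ) (b x : ℝ≥0) {t : ℝ≥0}
    (ht : 0 < t) : IsProbabilityMeasure (transitionKernel γ b t x) := by
  constructor
  simpa using lintegral_exp_transitionKernel hγ b x ht le_rfl

lemma integral_exp_transitionKernel {γ : ℝ} (hγ : 0 < γ) (b x : ℝ≥0) {t : ℝ≥0} (ht : 0 < t)
    {l : ℝ} (hl : 0 ≤ l) :
    ∫ y : ℝ≥0, Real.exp (-(l * y)) ∂(transitionKernel γ b t x) =
      (1 + l * (γ * t)) ^ (-(b / γ)) * Real.exp (-(l * x / (1 + l * (γ * t)))) := by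
  rw [integral_eq_lintegral_of_nonneg_ae (ae_of_all _ fun _ => Real.exp_nonneg _)
    (by fun_prop), lintegral_exp_transitionKernel hγ b x ht hl, ENNReal.toReal_ofReal]
  have : 0 < γ * t := by positivity
  positivity

/-! ### Density of exponentials in `C([0,∞])` -/

section Density
variable (𝕜 : Type*) [RCLike 𝕜]

/-- The function `x ↦ exp (-n x)` as an element of `C([0,∞])`. -/
noncomputable def expNeg (n : ℕ) : CZeroInfty 𝕜 :=
  ⟨BoundedContinuousFunction.ofNormedAddCommGroup
      (fun x : ℝ≥0 => ((Real.exp (-(n * x)) : ℝ) : 𝕜)) (by fun_prop) 1 (fun x => by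
        rw [RCLike.norm_ofReal, abs_of_nonneg (Real.exp_nonneg _), Real.exp_le_one_iff]
        simp only [Left.neg_nonpos_iff]; positivity), by
    rcases Nat.eq_zero_or_pos n with rfl | hn
    · exact ⟨1, by simp⟩
    · refine ⟨((0 : ℝ) : 𝕜), ?_⟩
      refine (RCLike.continuous_ofReal.tendsto 0).comp (Real.tendsto_exp_neg_atTop_nhds_zero.comp ?_)
      exact (NNReal.tendsto_coe_atTop.2 tendsto_id).const_mul_atTop (by exact_mod_cast hn)⟩

@[simp]
lemma expNeg_apply (n : ℕ) (x : ℝ≥0) :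
    (expNeg 𝕜 n : ℝ≥0 →ᵇ 𝕜) x = ((Real.exp (-(n * x)) : ℝ) : 𝕜) := rfl

variable {𝕜}

lemma exists_mem_span_expNeg_polynomial (p : Polynomial ℝ) :
    ∃ g ∈ Submodule.span 𝕜 (range (expNeg 𝕜)), ∀ x : ℝ≥0,
      (g : ℝ≥0 →ᵇ 𝕜) x = ((p.eval (Real.exp (-x)) : ℝ) : 𝕜) := by
  induction p using Polynomial.induction_on' with
  | add p q hp hq =>
    obtain ⟨g, hg, hg'⟩ := hp
    obtain ⟨h, hh, hh'⟩ := hq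
    exact ⟨g + h, add_mem hg hh, fun x => by simp [hg', hh']⟩
  | monomial n a =>
    refine ⟨(a : 𝕜) • expNeg 𝕜 n, Submodule.smul_mem _ _ (Submodule.subset_span ⟨n, rfl⟩),
      fun x => ?_⟩
    have : Real.exp (-(n * x)) = Real.exp (-x) ^ n := by rw [← Real.exp_nat_mul]; ring_nf
    simp [this, RCLike.real_smul_eq_coe_mul]

/-- A function in `C([0,∞])` is a continuous function of `exp (-x) ∈ [0,1]`. -/
lemma exists_continuousMap_unitInterval_eq (f : CZeroInfty 𝕜) :
    ∃ g : C(unitInterval, 𝕜), ∀ (x : ℝ≥0) (u : unitInterval), (u : ℝ) = Real.exp (-x) →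
      g u = (f : ℝ≥0 →ᵇ 𝕜) x := by
  obtain ⟨⟨f, l, hl⟩, rfl⟩ : ∃ f' : CZeroInfty 𝕜, f' = f := ⟨f, rfl⟩
  -- The value at `0` must be set by hand: since `Real.log 0 = 0`, the formula alone would give `f
  -- 0` instead of the limit at infinity.
  let g : unitInterval → 𝕜 := fun u => if (u : ℝ) = 0 then l else f (-Real.log u).toNNReal
  have hg : Continuous g := by
    rw [continuous_iff_continuousAt]
    intro u
    by_cases hu : (u : ℝ) = 0
    · have hu' : u = 0 := Subtype.ext hu
      subst hu'
      rw [continuousAt_iff_punctured_nhds]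
      have h0 : g 0 = l := by simp [g]
      rw [h0]
      have h1 : Tendsto (fun v : unitInterval => (v : ℝ)) (𝓝[≠] 0) (𝓝[≠] 0) := by
        refine tendsto_nhdsWithin_of_tendsto_nhds_of_eventually_within _ ?_ ?_
        · exact (continuous_subtype_val.tendsto (0 : unitInterval)).mono_left nhdsWithin_le_nhds
        · filter_upwards [self_mem_nhdsWithin] with v hv hv'
          exact hv (Subtype.ext hv')
      have h2 : Tendsto (fun v : unitInterval => (-Real.log v).toNNReal) (𝓝[≠] 0) atTop :=
        tendsto_real_toNNReal_atTop.comp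
          (tendsto_neg_atBot_atTop.comp (Real.tendsto_log_nhdsNE_zero.comp h1))
      refine (hl.comp h2).congr' ?_
      filter_upwards [self_mem_nhdsWithin] with v hv
      have : (v : ℝ) ≠ 0 := fun h => hv (Subtype.ext h)
      exact (if_neg this).symm
    · have h1 : ContinuousAt (fun v : unitInterval => f (-Real.log v).toNNReal) u :=
        f.continuous.continuousAt.comp (continuous_real_toNNReal.continuousAt.comp
          (continuous_subtype_val.continuousAt.log hu).neg)
      refine h1.congr ?_
      filter_upwards [continuous_subtype_val.continuousAt.eventually_ne hu] with v hv
      exact (if_neg hv).symm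
  refine ⟨⟨g, hg⟩, fun x u hu => ?_⟩
  have : (u : ℝ) ≠ 0 := hu ▸ (Real.exp_pos _).ne'
  change (if (u : ℝ) = 0 then l else _) = _
  rw [if_neg this, hu]
  simp

lemma norm_CZeroInfty_le {f : CZeroInfty 𝕜} {C : ℝ} (hC : 0 ≤ C) :
    ‖f‖ ≤ C ↔ ∀ x, ‖(f : ℝ≥0 →ᵇ 𝕜) x‖ ≤ C :=
  BoundedContinuousFunction.norm_le (f := (f : ℝ≥0 →ᵇ 𝕜)) hC

/-- The exponentials `x ↦ exp (-n x)` span a dense subspace of `C([0,∞])`. -/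
lemma exists_mem_span_expNeg_norm_sub_le (f : CZeroInfty 𝕜) {ε : ℝ} (hε : 0 < ε) :
    ∃ h ∈ Submodule.span 𝕜 (range (expNeg 𝕜)), ‖f - h‖ ≤ ε := by
  obtain ⟨g, hg⟩ := exists_continuousMap_unitInterval_eq f
  -- A Bernstein polynomial in `u = exp(-x)` is a combination of the functions `exp(-k x)`.
  obtain ⟨n, hn⟩ := (Metric.tendsto_nhds.1 (bernsteinApproximation_uniform g) ε hε).exists
  choose q hq hq' using fun k : Fin (n + 1) =>
    exists_mem_span_expNeg_polynomial (𝕜 := 𝕜) (bernsteinPolynomial ℝ n k)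
  refine ⟨∑ k, g (bernstein.z k) • q k, Submodule.sum_mem _ fun k _ =>
    Submodule.smul_mem _ _ (hq k), (norm_CZeroInfty_le hε.le).2 fun x => ?_⟩
  let u : unitInterval := ⟨Real.exp (-x), (Real.exp_pos _).le, by simp⟩
  have h1 : dist (bernsteinApproximation n g u) (g u) ≤ ε :=
    (ContinuousMap.dist_apply_le_dist u).trans hn.le
  rw [dist_comm, dist_eq_norm, hg x u rfl, bernsteinApproximation.apply] at h1
  have e : ((f - ∑ k, g (bernstein.z k) • q k : CZeroInfty 𝕜) : ℝ≥0 →ᵇ 𝕜) x =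
      (f : ℝ≥0 →ᵇ 𝕜) x - ∑ k : Fin (n + 1), bernstein n k u • g (bernstein.z k) := by
    rw [AddSubgroupClass.coe_sub, Submodule.coe_sum, BoundedContinuousFunction.sub_apply,
      BoundedContinuousFunction.sum_apply]
    congr 1
    refine Finset.sum_congr rfl fun k _ => ?_
    rw [Submodule.coe_smul, BoundedContinuousFunction.smul_apply, hq', smul_eq_mul,
      RCLike.real_smul_eq_coe_mul, mul_comm]
    rfl
  rwa [e]

end Density

/-! ### The operators on `C([0,∞])` and their dependence on `b` -/

section Operator
variable {𝕜 : Type*} [RCLike 𝕜] {γ : ℝ}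

/-- The transition probability at every time `t ≥ 0`. -/
noncomputable def transitionProb (γ : ℝ) (b t x : ℝ≥0) : Measure ℝ≥0 :=
  if t = 0 then Measure.dirac x else transitionKernel γ b t x

lemma isProbabilityMeasure_transitionProb (hγ : 0 < γ) (b t x : ℝ≥0) :
    IsProbabilityMeasure (transitionProb γ b t x) := by
  unfold transitionProb
  split_ifs with ht
  · infer_instance
  · exact isProbabilityMeasure_transitionKernel hγ b x (pos_iff_ne_zero.2 ht)

lemma semigroupFun_eq_integral (b t : ℝ≥0) (f : ℝ≥0 → 𝕜) (x : ℝ≥0) :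
    semigroupFun γ b t f x = ∫ y, f y ∂(transitionProb γ b t x) := by
  unfold semigroupFun transitionProb
  split_ifs <;> simp

lemma semigroupFun_add (hγ : 0 < γ) (b t : ℝ≥0) (f g : ℝ≥0 →ᵇ 𝕜) (x : ℝ≥0) :
    semigroupFun γ b t (f + g : ℝ≥0 →ᵇ 𝕜) x = semigroupFun γ b t f x + semigroupFun γ b t g x := by
  have := isProbabilityMeasure_transitionProb hγ b t x
  simp_rw [semigroupFun_eq_integral]
  exact integral_add (f.integrable _) (g.integrable _)

lemma semigroupFun_smul (b t : ℝ≥0) (c : 𝕜) (f : ℝ≥0 →ᵇ 𝕜) (x : ℝ≥0) :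
    semigroupFun γ b t (c • f : ℝ≥0 →ᵇ 𝕜) x = c * semigroupFun γ b t f x := by
  simp_rw [semigroupFun_eq_integral]
  exact integral_const_mul c f

lemma norm_semigroupFun_le (hγ : 0 < γ) (b t : ℝ≥0) (f : ℝ≥0 →ᵇ 𝕜) (x : ℝ≥0) :
    ‖semigroupFun γ b t f x‖ ≤ ‖f‖ := by
  have := isProbabilityMeasure_transitionProb hγ b t x
  rw [semigroupFun_eq_integral]
  exact f.norm_integral_le_norm _

/-- The closed form remains valid at `t = 0`, so later estimates need no case distinction. -/
lemma semigroupFun_expNeg (hγ : 0 < γ) (b t : ℝ≥0) (n : ℕ) (x : ℝ≥0) :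
    semigroupFun γ b t (expNeg 𝕜 n : ℝ≥0 →ᵇ 𝕜) x =
      (((1 + n * (γ * t)) ^ (-(b / γ)) * Real.exp (-(n * x / (1 + n * (γ * t)))) : ℝ) : 𝕜) := by
  unfold semigroupFun
  split_ifs with ht
  · simp [ht]
  · simp_rw [expNeg_apply, integral_ofReal,
      integral_exp_transitionKernel hγ b x (pos_iff_ne_zero.2 ht) n.cast_nonneg]

/-- `P_t^{γ,b}` maps the span of the exponentials into `C([0,∞])`. -/
lemma exists_eq_semigroupFun_of_mem_span (hγ : 0 < γ) (b t : ℝ≥0) {f : CZeroInfty 𝕜}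
    (hf : f ∈ Submodule.span 𝕜 (range (expNeg 𝕜))) :
    ∃ l : 𝕜, Continuous (semigroupFun γ b t (f : ℝ≥0 →ᵇ 𝕜)) ∧
      Tendsto (f : ℝ≥0 →ᵇ 𝕜) atTop (𝓝 l) ∧
      Tendsto (semigroupFun γ b t (f : ℝ≥0 →ᵇ 𝕜)) atTop (𝓝 l) := by
  induction hf using Submodule.span_induction with
  | mem f hf =>
    obtain ⟨n, rfl⟩ := hf
    have hd : 0 < 1 + n * (γ * t) := by positivity
    have h : semigroupFun γ b t (expNeg 𝕜 n : ℝ≥0 →ᵇ 𝕜) = _ :=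
      funext (semigroupFun_expNeg hγ b t n)
    rw [h]
    rcases Nat.eq_zero_or_pos n with rfl | hn
    · refine ⟨1, by fun_prop, ?_, ?_⟩
      · exact tendsto_const_nhds.congr fun x => by simp
      · simp
    · have key : ∀ c d : ℝ, 0 < d → Tendsto (fun x : ℝ≥0 => ((c * Real.exp (-(n * x / d)) : ℝ) : 𝕜))
          atTop (𝓝 ((c * 0 : ℝ) : 𝕜)) := by
        intro c d hd
        refine (RCLike.continuous_ofReal.tendsto _).comp
          ((Real.tendsto_exp_neg_atTop_nhds_zero.comp ?_).const_mul c)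
        exact ((NNReal.tendsto_coe_atTop.2 tendsto_id).const_mul_atTop
          (by exact_mod_cast hn)).atTop_div_const hd
      refine ⟨0, by fun_prop, ?_, ?_⟩
      · simpa using (key 1 1 one_pos).congr fun x => by simp
      · simpa using key _ _ hd
  | zero =>
    have h : semigroupFun γ b t ((0 : CZeroInfty 𝕜) : ℝ≥0 →ᵇ 𝕜) = fun _ => 0 := by
      ext x; simp [semigroupFun_eq_integral]
    rw [h]
    exact ⟨0, by fun_prop, tendsto_const_nhds (x := (0 : 𝕜)), tendsto_const_nhds⟩
  | add f g _ _ hf hg =>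
    obtain ⟨l, hf1, hf2, hf3⟩ := hf
    obtain ⟨m, hg1, hg2, hg3⟩ := hg
    have h : semigroupFun γ b t ((f + g : CZeroInfty 𝕜) : ℝ≥0 →ᵇ 𝕜) = _ :=
      funext (semigroupFun_add hγ b t (f : ℝ≥0 →ᵇ 𝕜) (g : ℝ≥0 →ᵇ 𝕜))
    rw [h]
    exact ⟨l + m, hf1.add hg1, hf2.add hg2, hf3.add hg3⟩
  | smul c f _ hf =>
    obtain ⟨l, hf1, hf2, hf3⟩ := hf
    have h : semigroupFun γ b t ((c • f : CZeroInfty 𝕜) : ℝ≥0 →ᵇ 𝕜) = _ :=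
      funext (semigroupFun_smul b t c (f : ℝ≥0 →ᵇ 𝕜))
    rw [h]
    exact ⟨c * l, hf1.const_mul c, hf2.const_mul c, hf3.const_mul c⟩

lemma norm_semigroupFun_sub_le (hγ : 0 < γ) (b t : ℝ≥0) (f g : CZeroInfty 𝕜) (x : ℝ≥0) :
    ‖semigroupFun γ b t (f : ℝ≥0 →ᵇ 𝕜) x - semigroupFun γ b t (g : ℝ≥0 →ᵇ 𝕜) x‖ ≤ ‖f - g‖ := by
  have h := semigroupFun_add hγ b t ((f - g : CZeroInfty 𝕜) : ℝ≥0 →ᵇ 𝕜) (g : ℝ≥0 →ᵇ 𝕜) x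
  rw [← Submodule.coe_add, sub_add_cancel] at h
  rw [h, add_sub_cancel_right]
  exact norm_semigroupFun_le hγ b t _ x

lemma continuous_semigroupFun (hγ : 0 < γ) (b t : ℝ≥0) (f : CZeroInfty 𝕜) :
    Continuous (semigroupFun γ b t (f : ℝ≥0 →ᵇ 𝕜)) := by
  refine continuous_of_uniform_approx_of_continuous fun u hu => ?_
  obtain ⟨ε, hε, hu⟩ := Metric.mem_uniformity_dist.1 hu
  obtain ⟨g, hg, hfg⟩ := exists_mem_span_expNeg_norm_sub_le f (half_pos hε)
  obtain ⟨l, hc, -⟩ := exists_eq_semigroupFun_of_mem_span hγ b t hg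
  refine ⟨_, hc, fun x => hu ?_⟩
  rw [dist_eq_norm]
  exact ((norm_semigroupFun_sub_le hγ b t f g x).trans hfg).trans_lt (half_lt_self hε)

/-- On the span, `P_t g - g` vanishes at infinity because both terms have the same limit there;
contractivity carries this to uniform limits. -/
lemma tendsto_semigroupFun_atTop (hγ : 0 < γ) (b t : ℝ≥0) (f : CZeroInfty 𝕜) {l : 𝕜}
    (hl : Tendsto (f : ℝ≥0 →ᵇ 𝕜) atTop (𝓝 l)) :
    Tendsto (semigroupFun γ b t (f : ℝ≥0 →ᵇ 𝕜)) atTop (𝓝 l) := by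
  have h0 : Tendsto (fun x => semigroupFun γ b t (f : ℝ≥0 →ᵇ 𝕜) x - (f : ℝ≥0 →ᵇ 𝕜) x)
      atTop (𝓝 0) := by
    rw [Metric.tendsto_nhds]
    intro ε hε
    obtain ⟨g, hg, hfg⟩ := exists_mem_span_expNeg_norm_sub_le f (show 0 < ε / 3 by positivity)
    obtain ⟨m, -, h1, h2⟩ := exists_eq_semigroupFun_of_mem_span hγ b t hg
    have h3 := h2.sub h1
    rw [sub_self] at h3
    filter_upwards [Metric.tendsto_nhds.1 h3 (ε / 3) (by positivity)] with x hx
    rw [dist_zero_right] at hx ⊢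
    have h4 := (norm_semigroupFun_sub_le hγ b t f g x).trans hfg
    have h5 : ‖(f : ℝ≥0 →ᵇ 𝕜) x - (g : ℝ≥0 →ᵇ 𝕜) x‖ ≤ ε / 3 :=
      (norm_CZeroInfty_le (f := f - g) (by positivity)).1 hfg x
    rw [norm_sub_rev] at h5
    have e : semigroupFun γ b t (f : ℝ≥0 →ᵇ 𝕜) x - (f : ℝ≥0 →ᵇ 𝕜) x =
      (semigroupFun γ b t (f : ℝ≥0 →ᵇ 𝕜) x - semigroupFun γ b t (g : ℝ≥0 →ᵇ 𝕜) x) +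
      (semigroupFun γ b t (g : ℝ≥0 →ᵇ 𝕜) x - (g : ℝ≥0 →ᵇ 𝕜) x) +
      ((g : ℝ≥0 →ᵇ 𝕜) x - (f : ℝ≥0 →ᵇ 𝕜) x) := by ring
    rw [e]
    refine norm_add₃_le.trans_lt ?_
    linarith
  simpa using h0.add hl

/-- The operator `P_t^{γ,b}` on `C([0,∞])`. -/
noncomputable def semigroupOp (hγ : 0 < γ) (b t : ℝ≥0) : CZeroInfty 𝕜 →L[𝕜] CZeroInfty 𝕜 :=
  LinearMap.mkContinuous
    { toFun := fun f => ⟨BoundedContinuousFunction.ofNormedAddCommGroup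
          (semigroupFun γ b t (f : ℝ≥0 →ᵇ 𝕜)) (continuous_semigroupFun hγ b t f) ‖f‖
          (norm_semigroupFun_le hγ b t (f : ℝ≥0 →ᵇ 𝕜)),
        let ⟨l, hl⟩ := f.2
        ⟨l, tendsto_semigroupFun_atTop hγ b t f hl⟩⟩
      map_add' := fun f g => Subtype.ext <| BoundedContinuousFunction.ext <|
        semigroupFun_add hγ b t (f : ℝ≥0 →ᵇ 𝕜) (g : ℝ≥0 →ᵇ 𝕜)
      map_smul' := fun c f => Subtype.ext <| BoundedContinuousFunction.ext <|
        semigroupFun_smul b t c (f : ℝ≥0 →ᵇ 𝕜) }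
    1 fun f => by
      rw [one_mul]
      exact (norm_CZeroInfty_le (norm_nonneg _)).2 (norm_semigroupFun_le hγ b t (f : ℝ≥0 →ᵇ 𝕜))

lemma semigroupOp_apply (hγ : 0 < γ) (b t : ℝ≥0) (f : CZeroInfty 𝕜) (x : ℝ≥0) :
    (semigroupOp hγ b t f : ℝ≥0 →ᵇ 𝕜) x = semigroupFun γ b t (f : ℝ≥0 →ᵇ 𝕜) x := rfl

lemma norm_semigroupOp_le (hγ : 0 < γ) (b t : ℝ≥0) (f : CZeroInfty 𝕜) :
    ‖semigroupOp hγ b t f‖ ≤ ‖f‖ :=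
  (norm_CZeroInfty_le (norm_nonneg _)).2 (norm_semigroupFun_le hγ b t (f : ℝ≥0 →ᵇ 𝕜))

/-- Both images share an exponential factor at most `1`. What remains is `1 - (1 + nγt)^(-b/γ) ≤
(b/γ) log(1 + nγt) ≤ b n t`, from `1 - exp(-u) ≤ u` and `log(1 + v) ≤ v`. -/
lemma norm_semigroupOp_sub_expNeg_le (hγ : 0 < γ) (b t : ℝ≥0) (n : ℕ) :
    ‖semigroupOp hγ b t (expNeg 𝕜 n) - semigroupOp hγ 0 t (expNeg 𝕜 n)‖ ≤ b * (n * t) := by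
  refine (norm_CZeroInfty_le (by positivity)).2 fun x => ?_
  have hd : 0 < 1 + n * (γ * t) := by positivity
  have e : ((semigroupOp hγ b t (expNeg 𝕜 n) - semigroupOp hγ 0 t (expNeg 𝕜 n) : CZeroInfty 𝕜) :
      ℝ≥0 →ᵇ 𝕜) x = ((((1 + n * (γ * t)) ^ (-(b / γ)) - 1) *
        Real.exp (-(n * x / (1 + n * (γ * t)))) : ℝ) : 𝕜) := by
    have h : ((semigroupOp hγ b t (expNeg 𝕜 n) - semigroupOp hγ 0 t (expNeg 𝕜 n) : CZeroInfty 𝕜) :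
      ℝ≥0 →ᵇ 𝕜) x = semigroupFun γ b t (expNeg 𝕜 n : ℝ≥0 →ᵇ 𝕜) x -
        semigroupFun γ 0 t (expNeg 𝕜 n : ℝ≥0 →ᵇ 𝕜) x := rfl
    rw [h, semigroupFun_expNeg hγ, semigroupFun_expNeg hγ, ← RCLike.ofReal_sub]
    congr 1
    simp only [NNReal.coe_zero, zero_div, neg_zero, Real.rpow_zero]
    ring
  have hlog0 : 0 ≤ Real.log (1 + n * (γ * t)) := Real.log_nonneg (by simp; positivity)
  have hlog : Real.log (1 + n * (γ * t)) ≤ n * (γ * t) := by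
    have := Real.log_le_sub_one_of_pos hd; linarith
  have h1 : (1 + n * (γ * t)) ^ (-(b / γ)) ≤ 1 :=
    Real.rpow_le_one_of_one_le_of_nonpos (by simp; positivity) (by simp; positivity)
  have h2 : 1 - (1 + n * (γ * t)) ^ (-(b / γ)) ≤ b * (n * t) := by
    rw [Real.rpow_def_of_pos hd]
    have := Real.add_one_le_exp (Real.log (1 + n * (γ * t)) * -(b / γ))
    have h3 : Real.log (1 + n * (γ * t)) * (b / γ) ≤ n * (γ * t) * (b / γ) := by gcongr
    have h4 : n * (γ * t) * (b / γ) = b * (n * t) := by field_simp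
    linarith
  rw [e, RCLike.norm_ofReal, abs_mul, abs_of_nonneg (Real.exp_nonneg _), abs_sub_comm,
    abs_of_nonneg (by linarith)]
  exact (mul_le_of_le_one_right (by linarith) (Real.exp_le_one_iff.2 (by
    simp only [Left.neg_nonpos_iff]; positivity))).trans h2

/-- On the span of the exponentials the convergence is linear in `b` and `t`. -/
lemma exists_norm_semigroupOp_sub_le_of_mem_span (hγ : 0 < γ) {f : CZeroInfty 𝕜}
    (hf : f ∈ Submodule.span 𝕜 (range (expNeg 𝕜))) :
    ∃ C : ℝ, 0 ≤ C ∧ ∀ b t : ℝ≥0, ‖semigroupOp hγ b t f - semigroupOp hγ 0 t f‖ ≤ b * (C * t) := by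
  induction hf using Submodule.span_induction with
  | mem f hf =>
    obtain ⟨n, rfl⟩ := hf
    exact ⟨n, n.cast_nonneg, fun b t => norm_semigroupOp_sub_expNeg_le hγ b t n⟩
  | zero => exact ⟨0, le_rfl, fun b t => by simp⟩
  | add f g _ _ hf hg =>
    obtain ⟨C, hC, hf⟩ := hf
    obtain ⟨D, hD, hg⟩ := hg
    refine ⟨C + D, by positivity, fun b t => ?_⟩
    rw [map_add, map_add, add_sub_add_comm]
    refine (norm_add_le_of_le (hf b t) (hg b t)).trans_eq (by ring)
  | smul c f _ hf =>
    obtain ⟨C, hC, hf⟩ := hf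
    refine ⟨‖c‖ * C, by positivity, fun b t => ?_⟩
    have e : semigroupOp hγ b t (c • f) - semigroupOp hγ 0 t (c • f) =
        c • (semigroupOp hγ b t f - semigroupOp hγ 0 t f) := by
      rw [map_smul, map_smul]
      exact (smul_sub c _ _).symm
    rw [e, norm_smul]
    calc _ ≤ ‖c‖ * (b * (C * t)) := by gcongr; exact hf b t
      _ = _ := by ring

end Operator

theorem corollary3p4 {𝕜 : Type*} [RCLike 𝕜] (γ : ℝ) (hγ : 0 < γ) :
    ∃ P : ℝ≥0 → ℝ≥0 → (CZeroInfty 𝕜 →L[𝕜] CZeroInfty 𝕜),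
      (∀ (b t : ℝ≥0) (f : CZeroInfty 𝕜) (x : ℝ≥0),
        (P b t f : ℝ≥0 →ᵇ 𝕜) x = semigroupFun γ b t (f : ℝ≥0 →ᵇ 𝕜) x) ∧
      ∀ f : CZeroInfty 𝕜, ∀ t₁ t₂ : ℝ≥0,
        TendstoUniformlyOn (fun b t => P b t f) (fun t => P 0 t f) (𝓝[>] (0 : ℝ≥0))
          (Icc t₁ t₂) := by
  refine ⟨semigroupOp hγ, semigroupOp_apply hγ, fun f t₁ t₂ => ?_⟩
  rw [Metric.tendstoUniformlyOn_iff]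
  intro ε hε
  obtain ⟨g, hg, hfg⟩ := exists_mem_span_expNeg_norm_sub_le f (show 0 < ε / 3 by positivity)
  obtain ⟨C, hC, hgC⟩ := exists_norm_semigroupOp_sub_le_of_mem_span hγ hg
  -- Replacing `t` by `t₂` makes the bound on the span uniform over the interval.
  have h0 : Tendsto (fun b : ℝ≥0 => (b : ℝ) * (C * t₂)) (𝓝[>] 0) (𝓝 0) := by
    have : Continuous fun b : ℝ≥0 => (b : ℝ) * (C * t₂) := by fun_prop
    simpa using (this.tendsto 0).mono_left nhdsWithin_le_nhds
  filter_upwards [h0.eventually_lt_const (show 0 < ε / 3 by positivity)] with b hb t ht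
  have hsub : ∀ b, ‖semigroupOp hγ b t f - semigroupOp hγ b t g‖ ≤ ε / 3 := fun b => by
    rw [← map_sub]
    exact (norm_semigroupOp_le hγ b t _).trans hfg
  have ht2 : (t : ℝ) ≤ t₂ := ht.2
  have h1 : ‖semigroupOp hγ b t g - semigroupOp hγ 0 t g‖ < ε / 3 :=
    ((hgC b t).trans (by gcongr)).trans_lt hb
  have h2 := hsub b
  have h3 := hsub 0
  rw [norm_sub_rev] at h3
  rw [dist_comm, dist_eq_norm]
  have e : semigroupOp hγ b t f - semigroupOp hγ 0 t f =
      (semigroupOp hγ b t f - semigroupOp hγ b t g) +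
      (semigroupOp hγ b t g - semigroupOp hγ 0 t g) +
      (semigroupOp hγ 0 t g - semigroupOp hγ 0 t f) := by abel
  rw [e]
  refine norm_add₃_le.trans_lt ?_
  linarith
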